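/- **Setting.** For distributions $p,q$ on a finite set $\mathcal X$ let $d_{\mathrm{TV}}(p,q)=\frac12\sum_i|p_i-q_i|$ and $d_{\mathrm h}^2(p,q)=\sum_i(\sqrt{p_i}-\sqrt{q_i})^2$. A channel $T:\mathcal X\to\mathbb N$ assigns to each $x\in\mathcal X$ a probability distribution $T(x)$ on $\mathbb N$; it is $\epsilon$-LDP if $\mathbb P[T(x)\in A]\le e^{\epsilon}\,\mathbb P[T(x')\in A]$ for all $x,x'\in\mathcal X$ and $A\subseteq\mathbb N$. Let $\mathrm n^*(p,q,\epsilon)\in\mathbb N\cup\{\infty\}$ be the smallest $n$ for which there are $\epsilon$-LDP channels $T_1,\dots,T_n$ and a test $\phi:\mathbb N^n\to\{p,q\}$ such that, when $X_1,\dots,X_n$ are i.i.d. and $Y_i=T_i(X_i)$ independently, $$\mathbb P_{X_i\sim p}(\phi(Y_1,\dots,Y_n)\ne p)+\mathbb P_{X_i\sim q}(\phi(Y_1,\dots,Y_n)\ne q)\le 0.1 ,$$ and let $\mathrm n^*(p,q)$ be the same quantity with arbitrary channels allowed. For $K>0$ let $\epsilon^*_K(p,q)=\inf\{\epsilon\ge0:\mathrm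 n^*(p,q,\epsilon)\le K\,\mathrm n^*(p,q)\}$ be the threshold for free privacy with constant $K$. **Theorem (sample complexity lower bound for general distributions).** There are universal constants $c,C>0$ such that for all $\rho,\nu\in(0,1/2)$ with $2\nu^2\le\rho\le\nu$ there exist distributions $p,q$ on a three-element set with $d_{\mathrm h}^2(p,q)=\rho$ and $d_{\mathrm{TV}}(p,q)=\nu$ for which the following hold. 1. For every $\epsilon\ge 0$, $c\,r\le\mathrm n^*(p,q,\epsilon)\le C\,r$ with $$r=\begin{cases}\dfrac1{\epsilon^2\nu^2}, & \epsilon\le1,\\[2mm] \min\left(\dfrac1{\nu^2},\dfrac1{e^{\epsilon}\rho^2}\right), & e\le e^{\epsilon}\le \dfrac1\rho,\\[2mm] \dfrac1\rho, & e^{\epsilon}>\dfrac1\rho\end{cases}$$ (where several cases apply, the bounds hold for each of them; for $\epsilon=0$ both sides are infinite). Without privacy constraint ($\epsilon=\infty$), $c/\rho\le\mathrm n^*(p,q)\le C/\rho$. 2. (Stagnant regime.) For every $K\ge1$ and every $\epsilon$ with $e\le e^{\epsilon}\le K\nu^2/\rho^2$, $$\frac{c}{K\nu^2}\le\mathrm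 n^*(p,q,\epsilon)\le\frac{C}{\nu^2}.$$ 3. (The threshold for free privacy can be as large as $1/d_{\mathrm h}^2$.) For every $K\ge C$ such that $CK\nu^2\le\rho$, $$\frac{c}{K\rho}\le e^{\epsilon^*_K(p,q)}\le\frac1\rho .$$ -/

import Mathlib

open MeasureTheory
open scoped ENNReal NNReal

namespace LDPTesting

noncomputable section

/-- Total variation distance of two distributions on a finite set. -/
def tvDist {α : Type*} [Fintype α] (p q : PMF α) : ℝ :=
  (1 / 2) * ∑ i, |(p i).toReal - (q i).toReal|

/-- Hellinger divergence (the squared distance, without a factor one half). -/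
def hellingerSq {α : Type*} [Fintype α] (p q : PMF α) : ℝ :=
  ∑ i, (Real.sqrt (p i).toReal - Real.sqrt (q i).toReal) ^ 2

/-- A channel with output alphabet `ℕ`: the law of the output for every input. -/
abbrev Channel (α : Type*) := α → PMF ℕ

/-- `ε`-local differential privacy of a channel. -/
def IsLDP {α : Type*} (ε : ℝ) (T : Channel α) : Prop :=
  ∀ (x x' : α) (A : Set ℕ),
    (T x).toMeasure A ≤ ENNReal.ofReal (Real.exp ε) * (T x').toMeasure A

/-- The pointwise form of local differential privacy. -/
theorem isLDP_iff {α : Type*} (ε : ℝ) (T : Channel α) :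
    IsLDP ε T ↔ ∀ (x x' : α) (y : ℕ), T x y ≤ ENNReal.ofReal (Real.exp ε) * T x' y := by
  constructor
  · intro h x x' y
    have := h x x' {y}
    rwa [PMF.toMeasure_apply_singleton _ _ (measurableSet_singleton y),
      PMF.toMeasure_apply_singleton _ _ (measurableSet_singleton y)] at this
  · intro h x x' A
    rw [PMF.toMeasure_apply _ (MeasurableSet.of_discrete),
      PMF.toMeasure_apply _ (MeasurableSet.of_discrete), ← ENNReal.tsum_mul_left]
    refine ENNReal.tsum_le_tsum fun y => ?_
    by_cases hy : y ∈ A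
    · simpa [hy] using h x x' y
    · simp [hy]

/-- The joint law of `(Y₁, …, Yₙ)`, where `X₁, …, Xₙ` are i.i.d. with law `r` and user `i`
independently outputs `Yᵢ = Tᵢ(Xᵢ)`. -/
def outputLaw {α : Type*} {n : ℕ} (R : Fin n → Channel α) (r : PMF α) : Measure (Fin n → ℕ) :=
  Measure.pi fun i => (r.bind (R i)).toMeasure

/-- `n` users with channels in `𝒞` suffice to test `p` against `q`: for some choice of channels
(one for each user) and some test `φ` (`true` means "p", `false` means "q"), the two error
probabilities sum to at most `0.1`. -/
def Solves {α : Type*} (𝒞 : Set (Channel α)) (p q : PMF α) (n : ℕ) : Prop :=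
  ∃ (R : Fin n → Channel α) (φ : (Fin n → ℕ) → Bool), (∀ i, R i ∈ 𝒞) ∧
    outputLaw R p {y | φ y ≠ true} + outputLaw R q {y | φ y ≠ false} ≤ ENNReal.ofReal 0.1

/-- Sample complexity under a channel constraint: the smallest sufficient number of users
(`⊤` if there is none). -/
def sampleComplexity {α : Type*} (𝒞 : Set (Channel α)) (p q : PMF α) : ℕ∞ :=
  ⨅ n ∈ {n : ℕ | Solves 𝒞 p q n}, (n : ℕ∞)

/-- Sample complexity `n*(p, q, ε)` under `ε`-local differential privacy. -/
def nStar {α : Type*} (p q : PMF α) (ε : ℝ) : ℕ∞ :=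
  sampleComplexity {T : Channel α | IsLDP ε T} p q

/-- Sample complexity `n*(p, q)` without privacy constraint (all channels are allowed). -/
def nStarNonprivate {α : Type*} (p q : PMF α) : ℕ∞ :=
  sampleComplexity (Set.univ : Set (Channel α)) p q

/-- Threshold for free privacy with constant `K`: the least `ε ≥ 0` for which
`n*(p, q, ε) ≤ K n*(p, q)`. -/
def freePrivacyThreshold {α : Type*} (K : ℝ≥0) (p q : PMF α) : ℝ :=
  sInf {ε : ℝ | 0 ≤ ε ∧ (nStar p q ε : ℝ≥0∞) ≤ (K : ℝ≥0∞) * (nStarNonprivate p q : ℝ≥0∞)}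

/-- `c · r ≤ N ≤ C · r`. -/
def Comparable (c C : ℝ≥0) (N : ℕ∞) (r : ℝ≥0∞) : Prop :=
  (c : ℝ≥0∞) * r ≤ (N : ℝ≥0∞) ∧ (N : ℝ≥0∞) ≤ (C : ℝ≥0∞) * r

end

end LDPTesting

namespace LDPTesting

/-! Take p = (0, (1-ν)/2, (1+ν)/2) and q = (a, (1+ν)/2 - a, (1-ν)/2). They differ in two ways: a
rare atom of mass a ≍ ρ, charged only by q, carries a constant fraction of the Hellinger divergence;
a shift of order ν on the bulk contributes only O(ν²) to it. Under ε-LDP an output can favour the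
rare atom over the bulk by at most a factor e^ε, so a user reveals at most about e^ε ρ² + ν², and
never more than ρ. The bulk term dominates until e^ε reaches ν²/ρ², whence stagnation; the rare atom
pays in full only at e^ε ≍ 1/ρ.

Lower bounds: the affinity ∑ √(PQ) of output laws tensorizes, and a good test forces it below 1/2,
so n is at least the inverse of the loss per user (`one_le_mul_of_solves`). That loss is bounded by
(P-Q)²/(P+Q) combined with the LDP ratios (`IsHardPair.le_nStar`, `IsHardPair.le_nStar_of_small`),
or by Hellinger data processing.

Upper bounds: randomized response to a yes/no question, counting and Chebyshev
(`nStar_le_of_event`). The event {0, 1} exploits the bulk, the event {0} the rare atom. -/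

/-! ### Affinity and the general lower bound -/

theorem tsum_pi_prod {n : ℕ} (f : Fin n → ℕ → ℝ≥0∞) :
    ∑' y : Fin n → ℕ, ∏ i, f i (y i) = ∏ i, ∑' k, f i k := by
  induction n with
  | zero => simp
  | succ n ih =>
    rw [← (Fin.consEquiv fun _ : Fin (n + 1) => ℕ).tsum_eq, ENNReal.tsum_prod', Fin.prod_univ_succ,
      ← ih, ← ENNReal.tsum_mul_right]
    refine tsum_congr fun k => ?_
    rw [← ENNReal.tsum_mul_left]
    refine tsum_congr fun y => ?_
    simp [Fin.consEquiv, Fin.prod_univ_succ]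

/-- Bernoulli's inequality (1 - h)ⁿ ≥ 1 - nh, free of subtraction; a factor above 1 only helps. -/
theorem one_le_prod_add_card_mul {ι : Type*} (S : Finset ι) {s : ι → ℝ≥0∞} {h : ℝ≥0∞}
    (hs : ∀ i, 1 ≤ s i + h) : 1 ≤ ∏ i ∈ S, s i + S.card * h := by
  classical
  induction S using Finset.induction_on with
  | empty => simp
  | insert i S hi ih =>
    rw [Finset.prod_insert hi, Finset.card_insert_of_notMem hi]
    push_cast
    rw [add_mul, one_mul, ← add_assoc]
    rcases le_total 1 (s i) with h1 | h1
    · calc (1 : ℝ≥0∞) ≤ 1 * ∏ j ∈ S, s j + S.card * h := by rwa [one_mul]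
        _ ≤ s i * ∏ j ∈ S, s j + S.card * h := by gcongr
        _ ≤ _ := le_self_add
    · calc (1 : ℝ≥0∞) ≤ s i * 1 + h := by rw [mul_one]; exact hs i
        _ ≤ s i * (∏ j ∈ S, s j + S.card * h) + h := by gcongr
        _ ≤ s i * ∏ j ∈ S, s j + 1 * (S.card * h) + h := by rw [mul_add]; gcongr
        _ = _ := by rw [one_mul]

/-- AM-GM, since 9/4 · 1/9 = 1/4. Here a is the mass on which the test errs. With total error 0.1
and total mass 2 the affinity is at most 9/40 + 2/9 < 1/2. -/
theorem sqrt_mul_le_error {a b : ℝ} (ha : 0 ≤ a) (hb : 0 ≤ b) :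
    √(a * b) ≤ 9 / 4 * a + 1 / 9 * (a + b) := by
  apply Real.sqrt_le_iff.mpr ⟨by positivity, ?_⟩
  nlinarith [sq_nonneg (9 / 4 * a - 1 / 9 * b), mul_nonneg ha hb]

theorem outputLaw_singleton {α : Type*} {n : ℕ} (R : Fin n → Channel α) (r : PMF α)
    (y : Fin n → ℕ) : outputLaw R r {y} = ∏ i, (r.bind (R i)) (y i) := by
  simp [outputLaw, Measure.pi_singleton,
    PMF.toMeasure_apply_singleton _ _ (measurableSet_singleton _)]

instance {α : Type*} {n : ℕ} (R : Fin n → Channel α) (r : PMF α) :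
    IsProbabilityMeasure (outputLaw R r) := by
  unfold outputLaw; infer_instance

theorem measure_eq_tsum {β : Type*} [Countable β] [MeasurableSpace β] [MeasurableSingletonClass β]
    (μ : Measure β) (s : Set β) : μ s = ∑' y, s.indicator (fun y => μ {y}) y := by
  rw [← Measure.tsum_indicator_apply_singleton μ s (Set.to_countable s).measurableSet]

/-- Lower bound on the affinity of the joint output laws in terms of the number of users, if every
coordinate loses at most `w` in affinity. -/
theorem one_le_mul_of_solves {α : Type*} [Fintype α] {𝒞 : Set (Channel α)} {p q : PMF α}
    {w : α → ℝ} (hw : ∀ x, 0 ≤ w x)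
    (h : ∀ T ∈ 𝒞, ∀ k, (p.bind T k).toReal + (q.bind T k).toReal ≤
      2 * √((p.bind T k).toReal * (q.bind T k).toReal) + ∑ x, w x * (T x k).toReal)
    {n : ℕ} (hs : Solves 𝒞 p q n) : 1 ≤ (n : ℝ) * ∑ x, w x := by
  obtain ⟨R, φ, hR, he⟩ := hs
  set W : ℝ := ∑ x, w x with hW
  have hW0 : 0 ≤ W := Finset.sum_nonneg fun x _ => hw x
  let P : Fin n → PMF ℕ := fun i => p.bind (R i)
  let Q : Fin n → PMF ℕ := fun i => q.bind (R i)
  let a : Fin n → ℕ → ℝ≥0∞ := fun i k => ENNReal.ofReal √((P i k).toReal * (Q i k).toReal)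
  -- Sum the pointwise hypothesis over outputs: each `R i x` has mass 1, so the weights add up to
  -- `W`.
  have hcoord : ∀ i, 1 ≤ ∑' k, a i k + ENNReal.ofReal (W / 2) := by
    intro i
    have hpt : ∀ k, P i k + Q i k ≤ 2 * a i k + ∑ x, ENNReal.ofReal (w x) * R i x k := by
      intro k
      have hx : ∀ x, ENNReal.ofReal (w x) * R i x k
          = ENNReal.ofReal (w x * (R i x k).toReal) := fun x => by
        rw [ENNReal.ofReal_mul (hw x), ENNReal.ofReal_toReal (PMF.apply_ne_top _ _)]
      rw [Finset.sum_congr rfl fun x _ => hx x, ← ENNReal.ofReal_sum_of_nonneg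
        fun x _ => mul_nonneg (hw x) ENNReal.toReal_nonneg,
        ← ENNReal.ofReal_toReal (PMF.apply_ne_top (P i) k),
        ← ENNReal.ofReal_toReal (PMF.apply_ne_top (Q i) k),
        ← ENNReal.ofReal_add ENNReal.toReal_nonneg ENNReal.toReal_nonneg,
        show (2 : ℝ≥0∞) = ENNReal.ofReal 2 by simp,
        ← ENNReal.ofReal_mul (by norm_num), ← ENNReal.ofReal_add (by positivity)
          (Finset.sum_nonneg fun x _ => mul_nonneg (hw x) ENNReal.toReal_nonneg)]
      exact ENNReal.ofReal_le_ofReal (h _ (hR i) k)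
    have hsum := ENNReal.tsum_le_tsum hpt
    rw [ENNReal.tsum_add, ENNReal.tsum_add, PMF.tsum_coe, PMF.tsum_coe, ENNReal.tsum_mul_left,
      Summable.tsum_finsetSum fun _ _ => ENNReal.summable] at hsum
    simp_rw [ENNReal.tsum_mul_left, PMF.tsum_coe, mul_one] at hsum
    rw [← ENNReal.ofReal_sum_of_nonneg fun x _ => hw x, ← hW] at hsum
    have h2 : ENNReal.ofReal W = 2 * ENNReal.ofReal (W / 2) := by
      rw [show (2 : ℝ≥0∞) = ENNReal.ofReal 2 by simp, ← ENNReal.ofReal_mul (by norm_num)]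
      congr 1; ring
    rw [h2, ← mul_add, one_add_one_eq_two] at hsum
    by_contra hlt
    push Not at hlt
    have := ENNReal.mul_lt_mul_right (a := 2) (by simp) (by simp) hlt
    rw [mul_one] at this
    exact absurd hsum (not_le.mpr this)
  have hprod := one_le_prod_add_card_mul (Finset.univ : Finset (Fin n)) hcoord
  rw [← tsum_pi_prod, Finset.card_univ, Fintype.card_fin] at hprod
  -- Whatever `φ` answers at `y`, exactly one of the two laws is misjudged there; its mass takes the
  -- factor 9/4.
  have hjoint : ∀ y : Fin n → ℕ, ∏ i, a i (y i) ≤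
      ENNReal.ofReal (9 / 4) * ({y | φ y ≠ true}.indicator (fun y => outputLaw R p {y}) y +
        {y | φ y ≠ false}.indicator (fun y => outputLaw R q {y}) y) +
      ENNReal.ofReal (1 / 9) * (outputLaw R p {y} + outputLaw R q {y}) := by
    intro y
    set A : ℝ := (outputLaw R p {y}).toReal with hA
    set B : ℝ := (outputLaw R q {y}).toReal with hB
    have hA' : outputLaw R p {y} = ENNReal.ofReal A := (ENNReal.ofReal_toReal (measure_ne_top _ _)).symm
    have hB' : outputLaw R q {y} = ENNReal.ofReal B := (ENNReal.ofReal_toReal (measure_ne_top _ _)).symm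
    have hA0 : 0 ≤ A := ENNReal.toReal_nonneg
    have hB0 : 0 ≤ B := ENNReal.toReal_nonneg
    have hl : ∏ i, a i (y i) = ENNReal.ofReal √(A * B) := by
      rw [hA, hB, outputLaw_singleton, outputLaw_singleton, ENNReal.toReal_prod,
        ENNReal.toReal_prod, ← Finset.prod_mul_distrib, Real.sqrt_prod _ fun i _ => by positivity,
        ENNReal.ofReal_prod_of_nonneg fun i _ => by positivity]
    rw [hl]
    cases hφ : φ y
    · rw [Set.indicator_of_mem (by simp [hφ]), Set.indicator_of_notMem (by simp [hφ]), add_zero,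
        hA', hB', ← ENNReal.ofReal_add hA0 hB0, ← ENNReal.ofReal_mul (by norm_num),
        ← ENNReal.ofReal_mul (by norm_num), ← ENNReal.ofReal_add (by positivity) (by positivity)]
      exact ENNReal.ofReal_le_ofReal (sqrt_mul_le_error hA0 hB0)
    · rw [Set.indicator_of_notMem (by simp [hφ]), Set.indicator_of_mem (by simp [hφ]), zero_add,
        hA', hB', ← ENNReal.ofReal_add hA0 hB0, ← ENNReal.ofReal_mul (by norm_num),
        ← ENNReal.ofReal_mul (by norm_num), ← ENNReal.ofReal_add (by positivity) (by positivity)]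
      refine ENNReal.ofReal_le_ofReal ?_
      rw [mul_comm A, add_comm A]
      exact sqrt_mul_le_error hB0 hA0
  have htot := ENNReal.tsum_le_tsum hjoint
  have hone : ∀ r : PMF α, ∑' y, outputLaw R r {y} = 1 := fun r => by
    have := measure_eq_tsum (outputLaw R r) Set.univ
    simpa using this.symm
  rw [ENNReal.tsum_add, ENNReal.tsum_mul_left, ENNReal.tsum_mul_left, ENNReal.tsum_add,
    ENNReal.tsum_add, ← measure_eq_tsum, ← measure_eq_tsum, hone, hone] at htot
  have hfin : (1 : ℝ≥0∞) ≤ ENNReal.ofReal (9 / 4) * ENNReal.ofReal 0.1 +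
      ENNReal.ofReal (1 / 9) * (1 + 1) + n * ENNReal.ofReal (W / 2) :=
    hprod.trans (by gcongr; exact htot.trans (by gcongr))
  rw [one_add_one_eq_two, show (2 : ℝ≥0∞) = ENNReal.ofReal 2 by simp,
    ← ENNReal.ofReal_natCast, ← ENNReal.ofReal_mul (by norm_num),
    ← ENNReal.ofReal_mul (by norm_num), ← ENNReal.ofReal_mul (by positivity),
    ← ENNReal.ofReal_add (by norm_num) (by norm_num),
    ← ENNReal.ofReal_add (by norm_num) (by positivity), ENNReal.one_le_ofReal] at hfin
  linarith

/-! ### Order properties of sample complexities -/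

theorem le_sampleComplexity {α : Type*} {𝒞 : Set (Channel α)} {p q : PMF α} {b : ℝ≥0∞}
    (h : ∀ n, Solves 𝒞 p q n → b ≤ n) : b ≤ (sampleComplexity 𝒞 p q : ℝ≥0∞) := by
  rcases Set.eq_empty_or_nonempty {n : ℕ | Solves 𝒞 p q n} with he | hne
  · simp [sampleComplexity, he]
  · have hm : sampleComplexity 𝒞 p q = (sInf {n : ℕ | Solves 𝒞 p q n} : ℕ) := by
      refine le_antisymm (iInf₂_le _ (Nat.sInf_mem hne)) (le_iInf₂ fun n hn => ?_)
      exact_mod_cast Nat.sInf_le hn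
    rw [hm]
    simpa using h _ (Nat.sInf_mem hne)

theorem sampleComplexity_le {α : Type*} {𝒞 : Set (Channel α)} {p q : PMF α} {n : ℕ}
    (h : Solves 𝒞 p q n) : (sampleComplexity 𝒞 p q : ℝ≥0∞) ≤ n := by
  have : sampleComplexity 𝒞 p q ≤ (n : ℕ∞) := iInf₂_le _ h
  exact_mod_cast ENat.toENNReal_le.mpr this

theorem sampleComplexity_anti {α : Type*} {𝒞 𝒟 : Set (Channel α)} (h : 𝒞 ⊆ 𝒟) (p q : PMF α) :
    sampleComplexity 𝒟 p q ≤ sampleComplexity 𝒞 p q :=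
  le_iInf₂ fun n ⟨R, φ, hR, he⟩ => iInf₂_le n ⟨R, φ, fun i => h (hR i), he⟩

theorem nStar_anti {α : Type*} {p q : PMF α} {ε ε' : ℝ} (h : ε ≤ ε') :
    nStar p q ε' ≤ nStar p q ε :=
  sampleComplexity_anti (fun _ hT x x' A => (hT x x' A).trans (by gcongr)) p q

theorem nStarNonprivate_le_nStar {α : Type*} (p q : PMF α) (ε : ℝ) :
    nStarNonprivate p q ≤ nStar p q ε :=
  sampleComplexity_anti (Set.subset_univ _) p q

/-- The sample complexity is at least `1 / H` if no user has an affinity loss above `H`. -/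
theorem div_ofReal_le_sampleComplexity {α : Type*} [Fintype α] {𝒞 : Set (Channel α)} {p q : PMF α}
    {w : α → ℝ} (hw : ∀ x, 0 ≤ w x)
    (h : ∀ T ∈ 𝒞, ∀ k, (p.bind T k).toReal + (q.bind T k).toReal ≤
      2 * √((p.bind T k).toReal * (q.bind T k).toReal) + ∑ x, w x * (T x k).toReal)
    {c : ℝ≥0} {r : ℝ} (hr : c * ∑ x, w x ≤ r) :
    (c : ℝ≥0∞) * (1 / ENNReal.ofReal r) ≤ (sampleComplexity 𝒞 p q : ℝ≥0∞) := by
  refine le_sampleComplexity fun n hn => ?_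
  have h1 := one_le_mul_of_solves hw h hn
  rw [mul_one_div]
  refine ENNReal.div_le_of_le_mul ?_
  rw [← ENNReal.ofReal_coe_nnreal, ← ENNReal.ofReal_natCast,
    ← ENNReal.ofReal_mul (by positivity)]
  refine ENNReal.ofReal_le_ofReal ?_
  have := mul_le_mul_of_nonneg_left h1 c.coe_nonneg
  have := mul_le_mul_of_nonneg_left hr (Nat.cast_nonneg (α := ℝ) n)
  linarith

/-! ### Counting tests -/

/-- The variance of an indicator is bounded by its mean, not by 1/4: the rate for the rare atom
relies on the output 1 being unlikely. -/
theorem chebyshev_count {n : ℕ} (μ : Measure ℕ) [IsProbabilityMeasure μ] {δ : ℝ} (hn : 0 < n)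
    (hδ : 0 < δ) :
    Measure.pi (fun _ : Fin n => μ)
      {y | n * δ ≤ |∑ i, (if y i = 1 then (1 : ℝ) else 0) - n * μ.real {1}|} ≤
      ENNReal.ofReal (μ.real {1} / (n * δ ^ 2)) := by
  set f : ℕ → ℝ := fun k => if k = 1 then (1 : ℝ) else 0 with hf
  have hfi : f = Set.indicator {1} 1 := by
    ext k; simp [hf, Set.indicator_apply]
  have hfm : MemLp f 2 μ := by
    refine MemLp.of_bound (by fun_prop) 1 (Filter.Eventually.of_forall fun k => ?_)
    simp only [hf]; split_ifs <;> simp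
  have hmean : ∫ k, f k ∂μ = μ.real {1} := by
    rw [hfi]; exact integral_indicator_one (measurableSet_singleton 1)
  have hvar : ProbabilityTheory.variance f μ ≤ μ.real {1} := by
    refine (ProbabilityTheory.variance_le_expectation_sq (by fun_prop)).trans_eq ?_
    rw [← hmean]
    congr 1; ext k; simp [hf]
  set X : (Fin n → ℕ) → ℝ := ∑ i, fun y => f (y i) with hX
  have hXm : MemLp X 2 (Measure.pi fun _ : Fin n => μ) :=
    memLp_finsetSum' _ fun i _ => hfm.comp_measurePreserving (measurePreserving_eval _ i)
  have hXv : ProbabilityTheory.variance X (Measure.pi fun _ : Fin n => μ)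
      = n * ProbabilityTheory.variance f μ := by
    rw [hX, ProbabilityTheory.variance_sum_pi (X := fun _ : Fin n => f) fun _ => hfm]
    simp
  have hXe : ∫ y, X y ∂(Measure.pi fun _ : Fin n => μ) = n * μ.real {1} := by
    simp only [hX, Finset.sum_apply]
    rw [integral_finsetSum _ fun i _ =>
      integrable_comp_eval (μ := fun _ : Fin n => μ) (hfm.integrable (by norm_num))]
    simp_rw [integral_comp_eval (μ := fun _ : Fin n => μ) (f := f) (by fun_prop), hmean]
    simp
  have hn' : (0 : ℝ) < n := by exact_mod_cast hn
  have hc := ProbabilityTheory.meas_ge_le_variance_div_sq hXm (c := n * δ) (by positivity)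
  rw [hXe, hXv] at hc
  refine (le_of_eq ?_).trans (hc.trans (ENNReal.ofReal_le_ofReal ?_))
  · congr 1; ext y; simp [hX, hf]
  · rw [div_le_div_iff₀ (by positivity) (by positivity)]
    have := mul_le_mul_of_nonneg_right hvar (by positivity : 0 ≤ (n : ℝ) * (n * δ ^ 2))
    nlinarith

/-- A single channel whose output `1` has probabilities `a < b` under `p`, `q` gives a test, by
thresholding the number of outputs `1`. -/
theorem solves_of_channel {α : Type*} {𝒞 : Set (Channel α)} {p q : PMF α} {T : Channel α}
    (hT : T ∈ 𝒞) {a b : ℝ} (ha : (p.bind T 1).toReal = a) (hb : (q.bind T 1).toReal = b)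
    (hab : a < b) {n : ℕ} (hn : 40 * (a + b) ≤ n * (b - a) ^ 2) : Solves 𝒞 p q n := by
  have ha0 : 0 ≤ a := ha ▸ ENNReal.toReal_nonneg
  have hn0 : 0 < n := by
    rcases Nat.eq_zero_or_pos n with h | h
    · subst h; push_cast at hn; linarith
    · exact h
  have hn' : (0 : ℝ) < n := by exact_mod_cast hn0
  have hr : ∀ r : PMF ℕ, r.toMeasure.real {1} = (r 1).toReal := fun r => by
    rw [Measure.real, PMF.toMeasure_apply_singleton _ _ (measurableSet_singleton 1)]
  -- The threshold is the midpoint, so the deviation is half the gap and the errors add up to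
  -- 4(a+b)/(n(b-a)²) ≤ 1/10; hence the 40.
  have hδ : 0 < (b - a) / 2 := by linarith
  refine ⟨fun _ => T, fun y => decide (∑ i, (if y i = 1 then (1 : ℝ) else 0) < n * ((a + b) / 2)),
    fun _ => hT, ?_⟩
  have hp := chebyshev_count (p.bind T).toMeasure hn0 hδ
  have hq := chebyshev_count (q.bind T).toMeasure hn0 hδ
  rw [hr, ha] at hp
  rw [hr, hb] at hq
  have hp' := (measure_mono (μ := Measure.pi fun _ : Fin n => (p.bind T).toMeasure)
    (s := {y | decide (∑ i, (if y i = 1 then (1 : ℝ) else 0) < n * ((a + b) / 2)) ≠ true})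
    fun y hy => ?_).trans hp
  · have hq' := (measure_mono (μ := Measure.pi fun _ : Fin n => (q.bind T).toMeasure)
      (s := {y | decide (∑ i, (if y i = 1 then (1 : ℝ) else 0) < n * ((a + b) / 2)) ≠ false})
      fun y hy => ?_).trans hq
    · refine (add_le_add hp' hq').trans ?_
      rw [← ENNReal.ofReal_add (by positivity) (by have := ha0.trans hab.le; positivity)]
      refine ENNReal.ofReal_le_ofReal ?_
      rw [← add_div, div_le_iff₀ (by positivity)]
      nlinarith
    · simp only [ne_eq, Bool.not_eq_false, decide_eq_true_eq, Set.mem_ofPred_eq] at hy ⊢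
      rw [abs_sub_comm]
      exact le_trans (by nlinarith) (le_abs_self _)
  · simp only [ne_eq, decide_eq_true_eq, Set.mem_ofPred_eq, not_lt] at hy ⊢
    exact le_trans (by nlinarith) (le_abs_self _)

/-! ### Randomized response -/

noncomputable section

/-- The Bernoulli law with success probability `r`, on `{0, 1} ⊆ ℕ`. -/
def natBernoulli (r : ℝ) (h0 : 0 ≤ r) (h1 : r ≤ 1) : PMF ℕ :=
  PMF.ofFinset (fun k => if k = 1 then ENNReal.ofReal r else if k = 0 then ENNReal.ofReal (1 - r)
    else 0) {0, 1} (by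
      rw [Finset.sum_pair zero_ne_one]
      simp only [zero_ne_one, if_false, if_true]
      rw [← ENNReal.ofReal_add (by linarith) h0]; simp)
    (by intro k hk; simp at hk; simp [hk.1, hk.2])

theorem natBernoulli_apply (r : ℝ) (h0 : 0 ≤ r) (h1 : r ≤ 1) (k : ℕ) :
    natBernoulli r h0 h1 k =
      if k = 1 then ENNReal.ofReal r else if k = 0 then ENNReal.ofReal (1 - r) else 0 := rfl

/-- The probability that randomized response to the question "`x ∈ S`?" reports `1`. -/
def responseProb {α : Type*} [DecidableEq α] (ε : ℝ) (S : Finset α) (x : α) : ℝ :=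
  (if x ∈ S then Real.exp ε else 1) / (1 + Real.exp ε)

theorem responseProb_nonneg {α : Type*} [DecidableEq α] (ε : ℝ) (S : Finset α) (x : α) :
    0 ≤ responseProb ε S x := by
  unfold responseProb; split_ifs <;> positivity

theorem responseProb_le_one {α : Type*} [DecidableEq α] (ε : ℝ) (S : Finset α) (x : α) :
    responseProb ε S x ≤ 1 := by
  have := Real.exp_pos ε
  unfold responseProb
  rw [div_le_one (by positivity)]
  split_ifs <;> linarith

theorem one_sub_responseProb {α : Type*} [DecidableEq α] (ε : ℝ) (S : Finset α) (x : α) :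
    1 - responseProb ε S x = (if x ∈ S then 1 else Real.exp ε) / (1 + Real.exp ε) := by
  have := Real.exp_pos ε
  unfold responseProb
  split_ifs <;> field_simp <;> ring

/-- Randomized response to the question "`x ∈ S`?". -/
def randomizedResponse {α : Type*} [DecidableEq α] (ε : ℝ) (S : Finset α) : Channel α := fun x =>
  natBernoulli (responseProb ε S x) (responseProb_nonneg ε S x) (responseProb_le_one ε S x)

theorem isLDP_randomizedResponse {α : Type*} [DecidableEq α] {ε : ℝ} (hε : 0 ≤ ε) (S : Finset α) :
    IsLDP ε (randomizedResponse ε S) := by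
  rw [isLDP_iff]
  intro x x' y
  have h1 : 1 ≤ Real.exp ε := Real.one_le_exp hε
  simp only [randomizedResponse, natBernoulli_apply]
  split_ifs
  · rw [← ENNReal.ofReal_mul (by positivity)]
    refine ENNReal.ofReal_le_ofReal ?_
    unfold responseProb
    rw [mul_div_assoc']
    gcongr
    split_ifs <;> nlinarith
  · rw [← ENNReal.ofReal_mul (by positivity)]
    refine ENNReal.ofReal_le_ofReal ?_
    rw [one_sub_responseProb, one_sub_responseProb, mul_div_assoc']
    gcongr
    split_ifs <;> nlinarith
  · simp

end

theorem toReal_bind_apply {α : Type*} [Fintype α] (p : PMF α) (T : Channel α) (k : ℕ) :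
    (p.bind T k).toReal = ∑ x, (p x).toReal * (T x k).toReal := by
  rw [PMF.bind_apply, tsum_fintype, ENNReal.toReal_sum fun x _ =>
    ENNReal.mul_ne_top (PMF.apply_ne_top _ _) (PMF.apply_ne_top _ _)]
  simp

theorem bind_randomizedResponse {α : Type*} [Fintype α] [DecidableEq α] (p : PMF α) (ε : ℝ)
    (S : Finset α) : (p.bind (randomizedResponse ε S) 1).toReal =
      (1 + (Real.exp ε - 1) * ∑ x ∈ S, (p x).toReal) / (1 + Real.exp ε) := by
  have hsum : ∑ x, (p x).toReal = 1 := by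
    rw [← ENNReal.toReal_sum fun x _ => PMF.apply_ne_top _ _, ← tsum_fintype (L := .unconditional _),
      PMF.tsum_coe, ENNReal.toReal_one]
  rw [toReal_bind_apply, eq_div_iff (by positivity), Finset.sum_mul]
  calc ∑ x, (p x).toReal * (randomizedResponse ε S x 1).toReal * (1 + Real.exp ε)
      = ∑ x, ((p x).toReal + (Real.exp ε - 1) * if x ∈ S then (p x).toReal else 0) := by
        refine Finset.sum_congr rfl fun x _ => ?_
        rw [randomizedResponse, natBernoulli_apply, if_pos rfl,
          ENNReal.toReal_ofReal (responseProb_nonneg ε S x), responseProb, mul_assoc,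
          div_mul_cancel₀ _ (by positivity)]
        split_ifs <;> ring
    _ = _ := by
        rw [Finset.sum_add_distrib, hsum, ← Finset.mul_sum]
        congr 2
        rw [← Finset.sum_filter]
        simp

/-- Upper bound for the private sample complexity by randomized response on an event `S` that has
probabilities `u < v` under the two distributions. -/
theorem nStar_le_of_event {α : Type*} [Fintype α] [DecidableEq α] {p q : PMF α} {ε : ℝ}
    (hε : 0 < ε) (S : Finset α) {u v : ℝ} (hu : ∑ x ∈ S, (p x).toReal = u)
    (hv : ∑ x ∈ S, (q x).toReal = v) (huv : u < v) {C : ℝ≥0} {X r : ℝ} (hr : 0 < r)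
    (hX : 40 * (2 + (Real.exp ε - 1) * (u + v)) * (1 + Real.exp ε) ≤
      X * ((Real.exp ε - 1) ^ 2 * (v - u) ^ 2)) (hX0 : 0 ≤ X) (hXC : (X + 1) * r ≤ C) :
    (nStar p q ε : ℝ≥0∞) ≤ (C : ℝ≥0∞) * (1 / ENNReal.ofReal r) := by
  have hE : 1 < Real.exp ε := Real.one_lt_exp_iff.mpr hε
  -- The `X + 1` in `hXC` pays for this rounding.
  have hs : Solves {T : Channel α | IsLDP ε T} p q ⌈X⌉₊ := by
    refine solves_of_channel (isLDP_randomizedResponse hε.le S)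
      (bind_randomizedResponse p ε S) (bind_randomizedResponse q ε S) ?_ ?_
    · rw [hu, hv]
      gcongr
    · rw [hu, hv]
      have h1 : X * ((Real.exp ε - 1) ^ 2 * (v - u) ^ 2) ≤
          ⌈X⌉₊ * ((Real.exp ε - 1) ^ 2 * (v - u) ^ 2) := by gcongr; exact Nat.le_ceil X
      have h2 := hX.trans h1
      rw [← add_div, ← sub_div, div_pow, mul_div_assoc', mul_div_assoc',
        div_le_div_iff₀ (by positivity) (by positivity)]
      have h3 := mul_le_mul_of_nonneg_right h2 (by positivity : 0 ≤ 1 + Real.exp ε)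
      linarith
  refine (sampleComplexity_le hs).trans ?_
  rw [mul_one_div, ENNReal.le_div_iff_mul_le (Or.inl (by simpa using hr)) (Or.inl (by simp)),
    ← ENNReal.ofReal_coe_nnreal, ← ENNReal.ofReal_natCast, ← ENNReal.ofReal_mul (by positivity)]
  refine ENNReal.ofReal_le_ofReal (le_trans ?_ hXC)
  gcongr
  exact (Nat.ceil_lt_add_one hX0).le

/-! ### Affinity loss at one output -/

/-- (√P - √Q)² ≤ (P-Q)²/(P+Q), because (√P + √Q)² ≥ P + Q; stated without division to allow P = Q =
0. -/
theorem add_le_two_mul_sqrt_add {P Q D : ℝ} (hP : 0 ≤ P) (hQ : 0 ≤ Q) (hD : 0 ≤ D)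
    (h : (P - Q) ^ 2 ≤ D * (P + Q)) : P + Q ≤ 2 * √(P * Q) + D := by
  rw [Real.sqrt_mul hP]
  obtain ⟨x, hx, rfl⟩ : ∃ x, 0 ≤ x ∧ x ^ 2 = P := ⟨√P, Real.sqrt_nonneg _, Real.sq_sqrt hP⟩
  obtain ⟨y, hy, rfl⟩ : ∃ y, 0 ≤ y ∧ y ^ 2 = Q := ⟨√Q, Real.sqrt_nonneg _, Real.sq_sqrt hQ⟩
  rw [Real.sqrt_sq hx, Real.sqrt_sq hy]
  suffices (x - y) ^ 2 ≤ D by nlinarith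
  by_contra! hlt
  have hxy : 0 < x ^ 2 + y ^ 2 := by
    rcases (by positivity : 0 ≤ x ^ 2 + y ^ 2).lt_or_eq with h0 | h0
    · exact h0
    · have hx0 : x = 0 := by nlinarith
      have hy0 : y = 0 := by nlinarith
      subst hx0 hy0
      simp at hlt
      linarith
  have := mul_lt_mul_of_pos_right hlt hxy
  nlinarith [mul_nonneg (mul_nonneg hx hy) (sq_nonneg (x - y))]

/-- Data processing for the Hellinger divergence, by Cauchy–Schwarz over inputs. -/
theorem add_le_two_mul_sqrt_add_hellinger {α : Type*} [Fintype α] (p q : PMF α) (T : Channel α)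
    (k : ℕ) : (p.bind T k).toReal + (q.bind T k).toReal ≤
      2 * √((p.bind T k).toReal * (q.bind T k).toReal) +
        ∑ x, (√(p x).toReal - √(q x).toReal) ^ 2 * (T x k).toReal := by
  rw [toReal_bind_apply, toReal_bind_apply,
    Real.sqrt_mul (Finset.sum_nonneg fun x _ => by positivity)]
  have hcs := Real.sum_sqrt_mul_sqrt_le (Finset.univ : Finset α)
    (f := fun x => (p x).toReal * (T x k).toReal) (g := fun x => (q x).toReal * (T x k).toReal)
    (fun x => by positivity) (fun x => by positivity)
  refine le_trans (le_of_eq ?_) (add_le_add_left (mul_le_mul_of_nonneg_left hcs zero_le_two) _)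
  rw [Finset.mul_sum, ← Finset.sum_add_distrib, ← Finset.sum_add_distrib]
  refine Finset.sum_congr rfl fun x _ => ?_
  rw [Real.sqrt_mul (by positivity), Real.sqrt_mul (by positivity)]
  have h1 := Real.sq_sqrt (ENNReal.toReal_nonneg (a := p x))
  have h2 := Real.sq_sqrt (ENNReal.toReal_nonneg (a := q x))
  have h3 := Real.mul_self_sqrt (ENNReal.toReal_nonneg (a := T x k))
  linear_combination (-(T x k).toReal) * h1 - (T x k).toReal * h2
    - 2 * √(p x).toReal * √(q x).toReal * h3

/-! ### The hard pair -/

/-- The pairs of distributions of the theorem: an atom of mass `a` that `p` does not charge, and a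
perturbation of size about `ν` on two atoms of order one. -/
structure IsHardPair (ρ ν a : ℝ) (p q : PMF (Fin 3)) : Prop where
  lower : ρ / 6 ≤ a
  upper : a ≤ ρ
  p0 : (p 0).toReal = 0
  p1 : (p 1).toReal = (1 - ν) / 2
  p2 : (p 2).toReal = (1 + ν) / 2
  q0 : (q 0).toReal = a
  q1 : (q 1).toReal = (1 + ν) / 2 - a
  q2 : (q 2).toReal = (1 - ν) / 2

theorem sq_sqrt_sub_sqrt_le {u v m : ℝ} (hu : 1 / 4 ≤ u) (hv : 1 / 4 ≤ v)
    (hm : m ≤ u + v + 1 / 2) : m * (√u - √v) ^ 2 ≤ (u - v) ^ 2 := by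
  have h1 := Real.sq_sqrt (by linarith : 0 ≤ u)
  have h2 := Real.sq_sqrt (by linarith : 0 ≤ v)
  have hu' : 1 / 2 ≤ √u := Real.le_sqrt_of_sq_le (by linarith)
  have hv' : 1 / 2 ≤ √v := Real.le_sqrt_of_sq_le (by linarith)
  have h3 : m ≤ (√u + √v) ^ 2 := by nlinarith
  calc m * (√u - √v) ^ 2 ≤ (√u + √v) ^ 2 * (√u - √v) ^ 2 := by gcongr
    _ = (√u ^ 2 - √v ^ 2) ^ 2 := by ring
    _ = _ := by rw [h1, h2]

theorem exists_pmf_fin_three {v : Fin 3 → ℝ} (h0 : ∀ i, 0 ≤ v i) (h1 : v 0 + v 1 + v 2 = 1) :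
    ∃ p : PMF (Fin 3), ∀ i, (p i).toReal = v i :=
  ⟨PMF.ofFintype (fun i => ENNReal.ofReal (v i)) (by
    rw [← ENNReal.ofReal_sum_of_nonneg fun i _ => h0 i, Fin.sum_univ_three, h1, ENNReal.ofReal_one]),
    fun i => by rw [PMF.ofFintype_apply, ENNReal.toReal_ofReal (h0 i)]⟩

theorem exists_isHardPair {ρ ν : ℝ} (hν : 0 < ν) (hν' : ν < 1 / 2) (h1 : 2 * ν ^ 2 ≤ ρ)
    (h2 : ρ ≤ ν) : ∃ a p q, IsHardPair ρ ν a p q ∧ hellingerSq p q = ρ ∧ tvDist p q = ν := by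
  set g : ℝ → ℝ := fun a => a + (√((1 - ν) / 2) - √((1 + ν) / 2 - a)) ^ 2 +
    (√((1 + ν) / 2) - √((1 - ν) / 2)) ^ 2 with hg
  have hB := sq_sqrt_sub_sqrt_le (u := (1 + ν) / 2) (v := (1 - ν) / 2) (m := 3 / 2)
    (by linarith) (by linarith) (by linarith)
  rw [show (1 + ν) / 2 - (1 - ν) / 2 = ν by ring] at hB
  have hA : ∀ a, 0 ≤ a → a ≤ ν → (√((1 - ν) / 2) - √((1 + ν) / 2 - a)) ^ 2 ≤ ν ^ 2 := by
    intro a ha ha'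
    have := sq_sqrt_sub_sqrt_le (u := (1 - ν) / 2) (v := (1 + ν) / 2 - a) (m := 1)
      (by linarith) (by linarith) (by linarith)
    nlinarith
  -- Total variation is ν for every a in [0, ν], so a is free to tune the Hellinger divergence: g(0)
  -- ≤ 5/3 ν² ≤ ρ and g(ν) ≥ ν ≥ ρ.
  obtain ⟨a, ⟨ha0, haν⟩, haρ⟩ : ρ ∈ g '' Set.Icc 0 ν := by
    refine intermediate_value_Icc hν.le (by simp only [hg]; fun_prop) ⟨?_, ?_⟩
    · have := hA 0 le_rfl hν.le
      simp only [hg]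
      nlinarith
    · simp only [hg]
      nlinarith [sq_nonneg (√((1 - ν) / 2) - √((1 + ν) / 2 - ν)),
        sq_nonneg (√((1 + ν) / 2) - √((1 - ν) / 2))]
  simp only [hg] at haρ
  obtain ⟨p, hp⟩ := exists_pmf_fin_three (v := ![0, (1 - ν) / 2, (1 + ν) / 2])
    (by intro i; fin_cases i <;> simp <;> linarith) (by simp; ring)
  obtain ⟨q, hq⟩ := exists_pmf_fin_three (v := ![a, (1 + ν) / 2 - a, (1 - ν) / 2])
    (by intro i; fin_cases i <;> simp <;> linarith) (by simp; ring)
  -- ρ - a ≤ ν² + 2/3 ν² ≤ 5/6 ρ.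
  have hlow : ρ / 6 ≤ a := by
    have := hA a ha0 haν
    linarith
  have hup : a ≤ ρ := by
    nlinarith [sq_nonneg (√((1 - ν) / 2) - √((1 + ν) / 2 - a)),
        sq_nonneg (√((1 + ν) / 2) - √((1 - ν) / 2))]
  have hpq : IsHardPair ρ ν a p q :=
    ⟨hlow, hup, by simp [hp], by simp [hp], by simp [hp], by simp [hq], by simp [hq], by simp [hq]⟩
  refine ⟨a, p, q, hpq, ?_, ?_⟩
  · rw [hellingerSq, Fin.sum_univ_three, hpq.p0, hpq.p1, hpq.p2, hpq.q0, hpq.q1, hpq.q2, ← haρ,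
      Real.sqrt_zero, zero_sub, neg_sq, Real.sq_sqrt ha0]
  · rw [tvDist, Fin.sum_univ_three, hpq.p0, hpq.p1, hpq.p2, hpq.q0, hpq.q1, hpq.q2, zero_sub,
      abs_neg, abs_of_nonneg ha0, abs_of_nonpos (by linarith), abs_of_nonneg (by linarith)]
    ring

theorem IsLDP.toReal_le {α : Type*} {ε : ℝ} {T : Channel α} (h : IsLDP ε T) (x x' : α) (k : ℕ) :
    (T x k).toReal ≤ Real.exp ε * (T x' k).toReal := by
  have := ENNReal.toReal_mono (ENNReal.mul_ne_top ENNReal.ofReal_ne_top (PMF.apply_ne_top _ _))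
    ((isLDP_iff ε T).mp h x x' k)
  rwa [ENNReal.toReal_mul, ENNReal.toReal_ofReal (Real.exp_pos ε).le] at this

/-! ### Sample complexity bounds for the hard pair -/

section HardPair

variable {ρ ν a : ℝ} {p q : PMF (Fin 3)}

theorem le_nStarNonprivate (hρ : hellingerSq p q = ρ) {c : ℝ≥0} (hc : c ≤ 1) :
    (c : ℝ≥0∞) * (1 / ENNReal.ofReal ρ) ≤ (nStarNonprivate p q : ℝ≥0∞) := by
  refine div_ofReal_le_sampleComplexity (fun x => sq_nonneg _)
    (fun T _ k => add_le_two_mul_sqrt_add_hellinger p q T k) ?_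
  change c * hellingerSq p q ≤ ρ
  have h0 : 0 ≤ hellingerSq p q := Finset.sum_nonneg fun _ _ => sq_nonneg _
  have hc' : (c : ℝ) ≤ 1 := by exact_mod_cast hc
  rw [← hρ]
  nlinarith

/-- As p - q has total mass zero, P - Q only involves differences from atom 2, each at most (e^ε -
1) t2, while P + Q ≥ t2/2. -/
theorem IsHardPair.le_nStar_of_small (h : IsHardPair ρ ν a p q) (hν' : ν < 1 / 2) (hρ : 0 < ρ)
    (hρν : ρ ≤ ν) {ε : ℝ} (hε : 0 ≤ ε) {c : ℝ≥0} {r : ℝ}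
    (hc : c * (2 * (Real.exp ε - 1) ^ 2 * ν ^ 2) ≤ r) :
    (c : ℝ≥0∞) * (1 / ENNReal.ofReal r) ≤ (nStar p q ε : ℝ≥0∞) := by
  have ha := h.lower
  have ha' := h.upper
  refine div_ofReal_le_sampleComplexity (w := ![0, 0, 2 * (Real.exp ε - 1) ^ 2 * ν ^ 2])
    (by intro i; fin_cases i <;> simp <;> positivity) (fun T hT k => ?_)
    (by simpa [Fin.sum_univ_three] using hc)
  have h02 := IsLDP.toReal_le hT 0 2 k
  have h20 := IsLDP.toReal_le hT 2 0 k
  have h12 := IsLDP.toReal_le hT 1 2 k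
  have h21 := IsLDP.toReal_le hT 2 1 k
  have hE : 1 ≤ Real.exp ε := Real.one_le_exp hε
  generalize Real.exp ε = E at *
  simp only [toReal_bind_apply, Fin.sum_univ_three, h.p0, h.p1, h.p2, h.q0, h.q1, h.q2,
    Matrix.cons_val_zero, Matrix.cons_val_one, Matrix.cons_val, zero_mul, zero_add]
  have ht0 : 0 ≤ (T 0 k).toReal := ENNReal.toReal_nonneg
  have ht1 : 0 ≤ (T 1 k).toReal := ENNReal.toReal_nonneg
  have ht2 : 0 ≤ (T 2 k).toReal := ENNReal.toReal_nonneg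
  generalize (T 0 k).toReal = t0 at *
  generalize (T 1 k).toReal = t1 at *
  generalize (T 2 k).toReal = t2 at *
  have hP : 1 / 4 * t2 ≤ (1 - ν) / 2 * t1 + (1 + ν) / 2 * t2 := by nlinarith
  have hQ : 1 / 4 * t2 ≤ a * t0 + ((1 + ν) / 2 - a) * t1 + (1 - ν) / 2 * t2 := by
    have : 0 ≤ a * t0 := mul_nonneg (by linarith) ht0
    have : 0 ≤ ((1 + ν) / 2 - a) * t1 := mul_nonneg (by linarith) ht1
    nlinarith
  have habs : ∀ t, t ≤ E * t2 → t2 ≤ E * t → 0 ≤ t → |t2 - t| ≤ (E - 1) * t2 := by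
    intro t h1 h2 h3
    rw [abs_le]
    constructor <;> nlinarith
  have hd0 := habs t0 h02 h20 ht0
  have hd1 := habs t1 h12 h21 ht1
  refine add_le_two_mul_sqrt_add (by linarith) (by linarith) (by positivity) ?_
  have hd : |(1 - ν) / 2 * t1 + (1 + ν) / 2 * t2 -
      (a * t0 + ((1 + ν) / 2 - a) * t1 + (1 - ν) / 2 * t2)| ≤ ν * ((E - 1) * t2) := by
    rw [show (1 - ν) / 2 * t1 + (1 + ν) / 2 * t2 -
      (a * t0 + ((1 + ν) / 2 - a) * t1 + (1 - ν) / 2 * t2) =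
        a * (t2 - t0) + (ν - a) * (t2 - t1) by ring]
    refine (abs_add_le _ _).trans ?_
    rw [abs_mul, abs_mul, abs_of_nonneg (by linarith : 0 ≤ a),
      abs_of_nonneg (by linarith : 0 ≤ ν - a)]
    have := mul_le_mul_of_nonneg_left hd0 (by linarith : 0 ≤ a)
    have := mul_le_mul_of_nonneg_left hd1 (by linarith : 0 ≤ ν - a)
    linarith
  have hsq := pow_le_pow_left₀ (abs_nonneg _) hd 2
  rw [sq_abs] at hsq
  refine hsq.trans ?_
  have : 2 * (E - 1) ^ 2 * ν ^ 2 * t2 * (1 / 2 * t2) ≤ 2 * (E - 1) ^ 2 * ν ^ 2 * t2 *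
      ((1 - ν) / 2 * t1 + (1 + ν) / 2 * t2 +
        (a * t0 + ((1 + ν) / 2 - a) * t1 + (1 - ν) / 2 * t2)) := by
    gcongr
    linarith
  linarith

/-- With s = t1 + t2: |P - Q| ≤ ρ t0 + ν s and P + Q ≥ s/2. Privacy gives 2 t0 ≤ e^ε s, which turns
the quadratic term ρ² t0² into one linear in t0. -/
theorem IsHardPair.le_nStar (h : IsHardPair ρ ν a p q) (hν' : ν < 1 / 2) (hρ : 0 < ρ)
    (hρν : ρ ≤ ν) {ε : ℝ} {c : ℝ≥0} {r : ℝ}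
    (hc : c * (2 * Real.exp ε * ρ ^ 2 + 8 * ν ^ 2) ≤ r) :
    (c : ℝ≥0∞) * (1 / ENNReal.ofReal r) ≤ (nStar p q ε : ℝ≥0∞) := by
  have ha := h.lower
  have ha' := h.upper
  refine div_ofReal_le_sampleComplexity (w := ![2 * Real.exp ε * ρ ^ 2, 4 * ν ^ 2, 4 * ν ^ 2])
    (by intro i; fin_cases i <;> simp <;> positivity) (fun T hT k => ?_)
    (le_trans (le_of_eq ?_) hc)
  swap
  · simp only [Fin.sum_univ_three, Matrix.cons_val_zero, Matrix.cons_val_one, Matrix.cons_val]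
    ring
  have h01 := IsLDP.toReal_le hT 0 1 k
  have h02 := IsLDP.toReal_le hT 0 2 k
  have hE := Real.exp_pos ε
  generalize Real.exp ε = E at *
  simp only [toReal_bind_apply, Fin.sum_univ_three, h.p0, h.p1, h.p2, h.q0, h.q1, h.q2,
    Matrix.cons_val_zero, Matrix.cons_val_one, Matrix.cons_val, zero_mul, zero_add]
  have ht0 : 0 ≤ (T 0 k).toReal := ENNReal.toReal_nonneg
  have ht1 : 0 ≤ (T 1 k).toReal := ENNReal.toReal_nonneg
  have ht2 : 0 ≤ (T 2 k).toReal := ENNReal.toReal_nonneg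
  generalize (T 0 k).toReal = t0 at *
  generalize (T 1 k).toReal = t1 at *
  generalize (T 2 k).toReal = t2 at *
  have hat : 0 ≤ a * t0 := mul_nonneg (by linarith) ht0
  have hP : 1 / 4 * (t1 + t2) ≤ (1 - ν) / 2 * t1 + (1 + ν) / 2 * t2 := by nlinarith
  have hQ : 1 / 4 * (t1 + t2) ≤ a * t0 + ((1 + ν) / 2 - a) * t1 + (1 - ν) / 2 * t2 := by
    nlinarith
  have hD : 0 ≤ 2 * E * ρ ^ 2 * t0 + 4 * ν ^ 2 * t1 + 4 * ν ^ 2 * t2 := by positivity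
  refine add_le_two_mul_sqrt_add (by linarith) (by linarith) hD ?_
  have hd : |(1 - ν) / 2 * t1 + (1 + ν) / 2 * t2 -
      (a * t0 + ((1 + ν) / 2 - a) * t1 + (1 - ν) / 2 * t2)| ≤ ρ * t0 + ν * (t1 + t2) := by
    have e1 : a * t0 ≤ ρ * t0 := by gcongr
    have e2 : 0 ≤ (ν - a) * t1 := mul_nonneg (by linarith) ht1
    have e3 : 0 ≤ a * t1 := mul_nonneg (by linarith) ht1
    have e4 : 0 ≤ ν * t2 := mul_nonneg (by linarith) ht2
    rw [abs_le]
    constructor <;> nlinarith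
  have hsq := pow_le_pow_left₀ (abs_nonneg _) hd 2
  rw [sq_abs] at hsq
  have hlow : (2 * E * ρ ^ 2 * t0 + 4 * ν ^ 2 * t1 + 4 * ν ^ 2 * t2) * (1 / 2 * (t1 + t2)) ≤
      (2 * E * ρ ^ 2 * t0 + 4 * ν ^ 2 * t1 + 4 * ν ^ 2 * t2) *
        ((1 - ν) / 2 * t1 + (1 + ν) / 2 * t2 +
          (a * t0 + ((1 + ν) / 2 - a) * t1 + (1 - ν) / 2 * t2)) := by
    gcongr
    linarith
  refine hsq.trans (le_trans ?_ hlow)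
  have h5 : ρ ^ 2 * t0 * (2 * t0) ≤ ρ ^ 2 * t0 * (E * t1 + E * t2) := by
    gcongr
    linarith
  nlinarith [sq_nonneg (ρ * t0 - ν * (t1 + t2))]

theorem IsHardPair.nStar_le_of_small (h : IsHardPair ρ ν a p q) (hν : 0 < ν) (hν' : ν < 1 / 2)
    {ε : ℝ} (hε : 0 < ε) (hε' : ε ≤ 1) {C : ℝ≥0} (hC : 641 ≤ C) :
    (nStar p q ε : ℝ≥0∞) ≤ (C : ℝ≥0∞) * (1 / ENNReal.ofReal (ε ^ 2 * ν ^ 2)) := by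
  have hC' : (641 : ℝ) ≤ C := by exact_mod_cast hC
  have hE : ε ≤ Real.exp ε - 1 := by linarith [Real.add_one_le_exp ε]
  have hE' : Real.exp ε ≤ 3 :=
    (Real.exp_le_exp.mpr hε').trans (by linarith [Real.exp_one_lt_d9])
  have hr : ε ^ 2 * ν ^ 2 ≤ 1 := by
    have : ε ^ 2 ≤ 1 := by nlinarith
    have : ν ^ 2 ≤ 1 := by nlinarith
    nlinarith [sq_nonneg ε, sq_nonneg ν]
  refine nStar_le_of_event hε {0, 1} (u := (1 - ν) / 2) (v := (1 + ν) / 2)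
    -- Here u + v = 1 and e^ε ≤ 3, so the left side of `hX` is 40(1 + e^ε)² ≤ 640.
    (X := 640 / (ε ^ 2 * ν ^ 2)) ?_ ?_ (by linarith) (by positivity) ?_ (by positivity) ?_
  · rw [Finset.sum_pair (by decide), h.p0, h.p1, zero_add]
  · rw [Finset.sum_pair (by decide), h.q0, h.q1]; ring
  · have h1 : 640 / (ε ^ 2 * ν ^ 2) * (ε ^ 2 * ν ^ 2) = 640 := by field_simp
    have h2 : 640 / (ε ^ 2 * ν ^ 2) * (ε ^ 2 * ν ^ 2) ≤ 640 / (ε ^ 2 * ν ^ 2) *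
        ((Real.exp ε - 1) ^ 2 * ((1 + ν) / 2 - (1 - ν) / 2) ^ 2) := by
      rw [show (1 + ν) / 2 - (1 - ν) / 2 = ν by ring]
      gcongr
    nlinarith [Real.exp_pos ε]
  · rw [add_mul, div_mul_cancel₀ _ (by positivity)]
    linarith

theorem IsHardPair.nStar_le_of_one_le (h : IsHardPair ρ ν a p q) (hν : 0 < ν) (hν' : ν < 1 / 2)
    {ε : ℝ} (hε : 1 ≤ ε) {C : ℝ≥0} (hC : 641 ≤ C) :
    (nStar p q ε : ℝ≥0∞) ≤ (C : ℝ≥0∞) * (1 / ENNReal.ofReal (ν ^ 2)) := by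
  have := h.nStar_le_of_small hν hν' one_pos le_rfl hC
  rw [one_pow, one_mul] at this
  exact (ENat.toENNReal_le.mpr (nStar_anti hε)).trans this

theorem IsHardPair.nStar_le_of_exp_le (h : IsHardPair ρ ν a p q) (hρ : 0 < ρ) (hρ' : ρ < 1 / 2)
    {ε : ℝ} (hε : 2 ≤ Real.exp ε) (hε' : Real.exp ε ≤ 1 / ρ) {C : ℝ≥0} (hC : 34561 ≤ C) :
    (nStar p q ε : ℝ≥0∞) ≤ (C : ℝ≥0∞) * (1 / ENNReal.ofReal (Real.exp ε * ρ ^ 2)) := by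
  have ha := h.lower
  have ha' := h.upper
  have hC' : (34561 : ℝ) ≤ C := by exact_mod_cast hC
  have hε0 : 0 < ε := Real.one_lt_exp_iff.mp (by linarith)
  rw [le_div_iff₀ hρ] at hε'
  generalize hE : Real.exp ε = E at *
  refine nStar_le_of_event hε0 {0} (u := 0) (v := a)
    -- 34560 = 240 · 144: the left side of `hX` is at most 240 E, and (E - 1)² a² ≥ E² ρ²/144.
    (X := 34560 / (E * ρ ^ 2)) ?_ ?_ (by linarith) (by positivity) ?_ (by positivity) ?_
  · rw [Finset.sum_singleton, h.p0]
  · rw [Finset.sum_singleton, h.q0]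
  · rw [hE]
    have h1 : 34560 / (E * ρ ^ 2) * ((E / 2) ^ 2 * (ρ / 6) ^ 2) = 240 * E := by
      field_simp; norm_num
    have h2 : 34560 / (E * ρ ^ 2) * ((E / 2) ^ 2 * (ρ / 6) ^ 2) ≤
        34560 / (E * ρ ^ 2) * ((E - 1) ^ 2 * (a - 0) ^ 2) := by
      gcongr <;> linarith
    have h3 : (E - 1) * (0 + a) ≤ 1 := by nlinarith
    have h4 : 0 ≤ (E - 1) * (0 + a) := mul_nonneg (by linarith) (by linarith)
    calc 40 * (2 + (E - 1) * (0 + a)) * (1 + E) ≤ 40 * (2 + 1) * (E + E) := by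
          gcongr; linarith
      _ = 240 * E := by ring
      _ ≤ _ := h1 ▸ h2
  · rw [add_mul, div_mul_cancel₀ _ (by positivity)]
    nlinarith

/-- At e^ε = 1/ρ the rate e^ε ρ² equals ρ; beyond it, monotonicity in ε suffices. -/
theorem IsHardPair.nStar_le_of_le_exp (h : IsHardPair ρ ν a p q) (hρ : 0 < ρ) (hρ' : ρ < 1 / 2)
    {ε : ℝ} (hε : 1 / ρ ≤ Real.exp ε) {C : ℝ≥0} (hC : 34561 ≤ C) :
    (nStar p q ε : ℝ≥0∞) ≤ (C : ℝ≥0∞) * (1 / ENNReal.ofReal ρ) := by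
  have hlog : Real.exp (Real.log (1 / ρ)) = 1 / ρ := Real.exp_log (by positivity)
  have h2 : 2 ≤ 1 / ρ := by rw [le_div_iff₀ hρ]; linarith
  have := h.nStar_le_of_exp_le hρ hρ' (hlog.symm ▸ h2) hlog.le hC
  rw [hlog, show 1 / ρ * ρ ^ 2 = ρ by field_simp] at this
  refine (ENat.toENNReal_le.mpr (nStar_anti ?_)).trans this
  rw [← Real.exp_le_exp, hlog]
  exact hε

/-- Any privacy level in the set defining the threshold for free privacy is large. -/
theorem IsHardPair.le_exp_of_nStar_le (h : IsHardPair ρ ν a p q) (hν' : ν < 1 / 2) (hρ : 0 < ρ)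
    (hρ' : ρ < 1 / 2) (hρν : ρ ≤ ν) {ε : ℝ} {C K : ℝ≥0} (hC : 34561 ≤ C) (hK : 1 ≤ K)
    (hCK : 16 * C * K * ν ^ 2 ≤ ρ)
    (hε : (nStar p q ε : ℝ≥0∞) ≤ (K : ℝ≥0∞) * (nStarNonprivate p q : ℝ≥0∞)) :
    1 / (4 * C * K * ρ) ≤ Real.exp ε := by
  have hC0 : (0 : ℝ) < C := lt_of_lt_of_le (by norm_num) (by exact_mod_cast hC : (34561 : ℝ) ≤ C)
  have hK0 : (0 : ℝ) < K := lt_of_lt_of_le one_pos (by exact_mod_cast hK)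
  have hE := Real.exp_pos ε
  have hlog : Real.exp (Real.log (1 / ρ)) = 1 / ρ := Real.exp_log (by positivity)
  have hlow := h.le_nStar hν' hρ hρν (ε := ε) (c := 1) (by rw [NNReal.coe_one, one_mul])
  have hup := (ENat.toENNReal_le.mpr (nStarNonprivate_le_nStar p q (Real.log (1 / ρ)))).trans
    (h.nStar_le_of_le_exp hρ hρ' hlog.ge hC)
  have hw : 0 < 2 * Real.exp ε * ρ ^ 2 + 8 * ν ^ 2 := by positivity
  have hall : ENNReal.ofReal (1 / (2 * Real.exp ε * ρ ^ 2 + 8 * ν ^ 2)) ≤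
      ENNReal.ofReal (K * (C * (1 / ρ))) := by
    rw [ENNReal.ofReal_div_of_pos hw, ENNReal.ofReal_mul K.coe_nonneg,
      ENNReal.ofReal_mul C.coe_nonneg, ENNReal.ofReal_div_of_pos hρ, ENNReal.ofReal_coe_nnreal,
      ENNReal.ofReal_coe_nnreal, ENNReal.ofReal_one]
    rw [ENNReal.coe_one, one_mul] at hlow
    exact hlow.trans (hε.trans (by gcongr))
  rw [ENNReal.ofReal_le_ofReal_iff (by positivity), div_le_iff₀ hw] at hall
  rw [div_le_iff₀ (by positivity)]
  have h1 : ρ * 1 ≤ ρ * (K * (C * (1 / ρ)) * (2 * Real.exp ε * ρ ^ 2 + 8 * ν ^ 2)) := by gcongr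
  rw [show ρ * (K * (C * (1 / ρ)) * (2 * Real.exp ε * ρ ^ 2 + 8 * ν ^ 2)) =
    2 * K * C * Real.exp ε * ρ ^ 2 + 8 * K * C * ν ^ 2 by field_simp] at h1
  -- `hCK` bounds the bulk term 8KCν² by ρ/2, so the rare atom must supply the other half.
  have h2 : ρ * 1 ≤ ρ * (Real.exp ε * (4 * C * K * ρ)) := by nlinarith
  exact le_of_mul_le_mul_left h2 hρ

end HardPair

end LDPTesting

/-! ### Assembly -/

theorem mainTheorem2 :
    ∃ c C : ℝ≥0, 0 < c ∧ 0 < C ∧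
      ∀ ρ ν : ℝ, 0 < ρ → ρ < 1 / 2 → 0 < ν → ν < 1 / 2 → 2 * ν ^ 2 ≤ ρ → ρ ≤ ν →
        ∃ p q : PMF (Fin 3),
          LDPTesting.hellingerSq p q = ρ ∧
          LDPTesting.tvDist p q = ν ∧
          -- the sample complexity; for `ε = 0` both sides are infinite
          (∀ ε : ℝ, 0 ≤ ε → ε ≤ 1 →
            LDPTesting.Comparable c C (LDPTesting.nStar p q ε)
              (1 / ENNReal.ofReal (ε ^ 2 * ν ^ 2))) ∧
          (∀ ε : ℝ, Real.exp 1 ≤ Real.exp ε → Real.exp ε ≤ 1 / ρ →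
            LDPTesting.Comparable c C (LDPTesting.nStar p q ε)
              (min (1 / ENNReal.ofReal (ν ^ 2)) (1 / ENNReal.ofReal (Real.exp ε * ρ ^ 2)))) ∧
          (∀ ε : ℝ, 1 / ρ < Real.exp ε →
            LDPTesting.Comparable c C (LDPTesting.nStar p q ε) (1 / ENNReal.ofReal ρ)) ∧
          LDPTesting.Comparable c C (LDPTesting.nStarNonprivate p q) (1 / ENNReal.ofReal ρ) ∧
          -- the stagnant regime
          (∀ (K : ℝ≥0) (ε : ℝ), 1 ≤ K → Real.exp 1 ≤ Real.exp ε →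
            Real.exp ε ≤ K * (ν ^ 2 / ρ ^ 2) →
            LDPTesting.Comparable (c / K) C (LDPTesting.nStar p q ε)
              (1 / ENNReal.ofReal (ν ^ 2))) ∧
          -- the threshold for free privacy
          (∀ K : ℝ≥0, C ≤ K → C * K * ν ^ 2 ≤ ρ →
            c / (K * ρ) ≤ Real.exp (LDPTesting.freePrivacyThreshold K p q) ∧
            Real.exp (LDPTesting.freePrivacyThreshold K p q) ≤ 1 / ρ) := by
  have hC₁ : (34561 : ℝ≥0) ≤ 640000 := by norm_num
  have hC₂ : (641 : ℝ≥0) ≤ 640000 := by norm_num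
  have hc₁ : (1 / 160000 : ℝ≥0) ≤ 1 := by
    rw [← NNReal.coe_le_coe]; norm_num
  -- Dictated by the threshold bound with 40000 ≥ 34561 as its constant: 16 · 40000 and 4 · 40000.
  refine ⟨1 / 160000, 640000, by positivity, by positivity, fun ρ ν hρ hρ' hν hν' h1 h2 => ?_⟩
  obtain ⟨a, p, q, h, hh, htv⟩ := LDPTesting.exists_isHardPair hν hν' h1 h2
  have hlog : Real.exp (Real.log (1 / ρ)) = 1 / ρ := Real.exp_log (by positivity)
  have hlow : ∀ ε, ((1 / 160000 : ℝ≥0) : ℝ≥0∞) * (1 / ENNReal.ofReal ρ) ≤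
      (LDPTesting.nStar p q ε : ℝ≥0∞) := fun ε =>
    (LDPTesting.le_nStarNonprivate hh hc₁).trans
      (ENat.toENNReal_le.mpr (LDPTesting.nStarNonprivate_le_nStar p q ε))
  have hmem : ∀ K : ℝ≥0, 640000 ≤ K → Real.log (1 / ρ) ∈ {ε : ℝ | 0 ≤ ε ∧
      (LDPTesting.nStar p q ε : ℝ≥0∞) ≤ (K : ℝ≥0∞) * (LDPTesting.nStarNonprivate p q : ℝ≥0∞)} := by
    refine fun K hK => ⟨Real.log_nonneg ?_, ?_⟩
    · rw [le_div_iff₀ hρ]; linarith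
    · refine (h.nStar_le_of_le_exp hρ hρ' hlog.ge (hC₁.trans hK)).trans ?_
      gcongr
      simpa using LDPTesting.le_nStarNonprivate hh le_rfl
  refine ⟨p, q, hh, htv, fun ε hε hε' => ⟨?_, ?_⟩, fun ε hε hε' => ⟨?_, ?_⟩, fun ε hε =>
    ⟨hlow ε, h.nStar_le_of_le_exp hρ hρ' hε.le hC₁⟩, ⟨LDPTesting.le_nStarNonprivate hh hc₁, ?_⟩,
    fun K ε hK hε hε' => ⟨?_, ?_⟩, fun K hK hCK => ⟨?_, ?_⟩⟩
  · refine h.le_nStar_of_small hν' hρ h2 hε ?_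
    have hb := Real.abs_exp_sub_one_le (x := ε) (by rwa [abs_of_nonneg hε])
    have hb' := pow_le_pow_left₀ (abs_nonneg _) hb 2
    rw [sq_abs, mul_pow, sq_abs] at hb'
    have hb'' := mul_le_mul_of_nonneg_right hb' (sq_nonneg ν)
    push_cast
    nlinarith [mul_nonneg (sq_nonneg ε) (sq_nonneg ν)]
  · rcases hε.eq_or_lt with rfl | hε0
    · simp [ENNReal.mul_top]
    · exact h.nStar_le_of_small hν hν' hε0 hε' hC₂
  -- The larger of e^ε ρ² and ν² controls their weighted sum up to a factor 10.
  · rcases le_total (Real.exp ε * ρ ^ 2) (ν ^ 2) with hle | hle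
    · refine le_trans (mul_le_mul_right (min_le_left _ _) _) (h.le_nStar hν' hρ h2 ?_)
      push_cast
      nlinarith
    · refine le_trans (mul_le_mul_right (min_le_right _ _) _) (h.le_nStar hν' hρ h2 ?_)
      push_cast
      nlinarith
  · rcases min_choice (1 / ENNReal.ofReal (ν ^ 2)) (1 / ENNReal.ofReal (Real.exp ε * ρ ^ 2))
      with hm | hm <;> rw [hm]
    · exact h.nStar_le_of_one_le hν hν' (Real.exp_le_exp.mp hε) hC₂
    · exact h.nStar_le_of_exp_le hρ hρ' (by linarith [Real.exp_one_gt_d9]) hε' hC₁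
  · exact (ENat.toENNReal_le.mpr (LDPTesting.nStarNonprivate_le_nStar p q _)).trans
      (h.nStar_le_of_le_exp hρ hρ' hlog.ge hC₁)
  · have hK' : (1 : ℝ) ≤ K := by exact_mod_cast hK
    refine h.le_nStar hν' hρ h2 ?_
    have he : Real.exp ε * ρ ^ 2 ≤ K * ν ^ 2 := by
      calc Real.exp ε * ρ ^ 2 ≤ K * (ν ^ 2 / ρ ^ 2) * ρ ^ 2 := by gcongr
        _ = K * ν ^ 2 := by field_simp
    push_cast
    rw [div_div, one_div_mul_eq_div, div_le_iff₀ (by positivity)]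
    nlinarith [sq_nonneg ν]
  · exact h.nStar_le_of_one_le hν hν' (Real.exp_le_exp.mp hε) hC₂
  · have hK1 : (1 : ℝ≥0) ≤ K := le_trans (by norm_num) hK
    have hK0 : (0 : ℝ) < K := lt_of_lt_of_le one_pos (by exact_mod_cast hK1)
    rw [← Real.log_le_iff_le_exp (by positivity)]
    refine le_csInf ⟨_, hmem K hK⟩ fun ε hε => ?_
    rw [Real.log_le_iff_le_exp (by positivity)]
    have := h.le_exp_of_nStar_le hν' hρ hρ' h2 (C := 40000) (by norm_num) hK1 (by
      push_cast at hCK ⊢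
      linarith) hε.2
    refine le_trans (le_of_eq ?_) this
    push_cast
    field_simp
    norm_num
  · rw [← hlog, Real.exp_le_exp]
    exact csInf_le ⟨0, fun ε hε => hε.1⟩ (hmem K hK)
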